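/- Let $\alpha\in(0,1)$ be irrational with regular continued fraction expansion $\alpha=[0;a_1,a_2,\ldots]$. Let $F_\alpha(t)=t+\alpha \bmod 1$ on $\mathbb T=[0,1)$, $I_0=[0,1-\alpha)$, $I_1=[1-\alpha,1)$, and for a word $u=u_0\ldots u_{n-1}$ over $\{0,1\}$ let $I_u=\{t\in\mathbb T : F_\alpha^k(t)\in I_{u_k},\ 0\le k<n\}$. Let $$\Sigma_\alpha=\{x\in\{0,1\}^{\mathbb N} : I_{x_0\ldots x_{n-1}}\neq\emptyset \text{ for all } n\in\mathbb N\}$$ be the associated Sturmian shift, with the shift map $\sigma(x)_i=x_{i+1}$, and let $\mu$ be its (unique) $\sigma$-invariant Borel probability measure. For $x\in\Sigma_\alpha$ let $[x(n)]=\{y\in\Sigma_\alpha : y_i=x_i,\ 0\le i<n\}$, for $M\subseteq\Sigma_\alpha$ let $\tau(M)=\min\{k>0 : \sigma^k(M)\cap M\ne\emptyset\}$ (with $\min\emptyset=\infty$), and define the local return rates $$\underline R(x)=\liminf_{n\to\infty}\frac{\tau([x(n)])}{n},\qquad \overline R(x)=\limsup_{n\to\infty}\frac{\tau([x(n)])}{n}\qquad\text{in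 }[0,\infty].$$ If the sequence $(a_k)_{k\ge1}$ is unbounded, then $\underline R(x)=0$ and $\overline R(x)=\infty$ for $\mu$-almost every $x\in\Sigma_\alpha$. -/

import Mathlib

open MeasureTheory Filter Topology
open scoped ENNReal

namespace Sturmian

/-- The Poincaré return time `τ(M) = min {k > 0 | F^k(M) ∩ M ≠ ∅}` of a set `M` under `F`,
with value `⊤` when there is no such `k`. -/
noncomputable def returnTime {X : Type*} (F : X → X) (M : Set X) : ℕ∞ :=
  ⨅ (k : ℕ) (_ : 0 < k ∧ ((F^[k] '' M) ∩ M).Nonempty), (k : ℕ∞)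

/-- The shift map on one-sided infinite sequences. -/
def shift {A : Type*} (x : ℕ → A) : ℕ → A := fun i => x (i + 1)

/-- The prefix `x(n) = x₀ x₁ … xₙ₋₁` of length `n`. -/
def pref {A : Type*} (x : ℕ → A) (n : ℕ) : Fin n → A := fun i => x i

/-- The cylinder of the word `u` inside the set `S` of sequences, as a subset of `S`. -/
def cylinder {A : Type*} (S : Set (ℕ → A)) {n : ℕ} (u : Fin n → A) : Set S :=
  {y | ∀ i : Fin n, (y : ℕ → A) i = u i}

/-- The lower local return rate of the subshift `(S, F)` at `x`. -/
noncomputable def lowerReturnRate {A : Type*} (S : Set (ℕ → A)) (F : S → S) (x : S) : ℝ≥0∞ :=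
  liminf (fun n : ℕ => (returnTime F (cylinder S (pref (x : ℕ → A) n)) : ℝ≥0∞) / (n : ℝ≥0∞)) atTop

/-- The upper local return rate of the subshift `(S, F)` at `x`. -/
noncomputable def upperReturnRate {A : Type*} (S : Set (ℕ → A)) (F : S → S) (x : S) : ℝ≥0∞ :=
  limsup (fun n : ℕ => (returnTime F (cylinder S (pref (x : ℕ → A) n)) : ℝ≥0∞) / (n : ℝ≥0∞)) atTop

/-- The rotation `t ↦ t + α mod 1`; the circle is represented by `[0, 1)`. -/
noncomputable def rotation (α : ℝ) (t : ℝ) : ℝ := Int.fract (t + α)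

/-- The canonical partition `I₀ = [0, 1 - α)`, `I₁ = [1 - α, 1)` of the circle. -/
def letterInterval (α : ℝ) (a : Fin 2) : Set ℝ :=
  if a = 0 then Set.Ico 0 (1 - α) else Set.Ico (1 - α) 1

/-- The set `I_u` of the points of the circle whose itinerary starts with the word `u`. -/
def wordInterval (α : ℝ) {n : ℕ} (u : Fin n → Fin 2) : Set ℝ :=
  {t | t ∈ Set.Ico (0 : ℝ) 1 ∧ ∀ k : Fin n, (rotation α)^[k] t ∈ letterInterval α (u k)}

/-- The Sturmian shift of angle `α`: the sequences all of whose prefixes have `I_{x(n)} ≠ ∅`. -/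
def sturmianShift (α : ℝ) : Set (ℕ → Fin 2) :=
  {x | ∀ n : ℕ, (wordInterval α (pref x n)).Nonempty}

theorem shift_mem_sturmianShift {α : ℝ} {x : ℕ → Fin 2} (hx : x ∈ sturmianShift α) :
    shift x ∈ sturmianShift α := by
  intro n
  obtain ⟨t, -, h⟩ := hx (n + 1)
  refine ⟨rotation α t, ⟨Int.fract_nonneg _, Int.fract_lt_one _⟩, fun k => ?_⟩
  simpa [pref, shift, Function.iterate_succ_apply] using h k.succ

/-- The shift map restricted to the Sturmian shift. -/
def sturmianMap (α : ℝ) (x : sturmianShift α) : sturmianShift α :=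
  ⟨shift (x : ℕ → Fin 2), shift_mem_sturmianShift x.2⟩

/-- The partial quotients `a₁, a₂, …` of the (regular) continued fraction of `α = [a₀; a₁, a₂, …]`
are unbounded. -/
def UnboundedPartialQuotients (α : ℝ) : Prop :=
  ¬ BddAbove {b : ℝ | ∃ n : ℕ, (GenContFract.of α).partDens.get? n = some b}

end Sturmian

namespace Sturmian

/-! ### Rational approximation -/

/-! Write `R` for the rotation, `δ = qα - p` for a reduced fraction `p/q`, and `x` for the itinerary
of `t`. Unbounded partial quotients give fractions with `q → ∞` and `q|δ|` as small as desired, and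
`R^q` is then translation by the tiny `δ`.

Lower rate: if the orbit of `t` up to time `n = (m+1)q` stays where adding `δ` does not cross 0,
then `x` has period `q` along its prefix and the return time is at most `q`
(`IsItinerary.apply_add_eq`). The exceptional set has measure at most `(n+1)|δ|`, summable along a
good sequence, so Borel–Cantelli applies (`ae_frequently_recurrent`).

Upper rate: if `R^n t` lies in the window, the arc of length `|δ|` that translation by `-δ` moves
across 0, and `n ≥ q`, then `R^n` sends the whole interval of `x(n)` into the window. A return time
`k` thus brings `kα` within `|δ|` of an integer, which forces `k ≥ 1/(2|δ|)`
(`mul_le_returnTime_cylinder`). Hits at times between `q` and about `1/(2K|δ|)` are disjoint events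
of total measure at least `1/(4K)`; ergodicity raises positive measure to full measure
(`ae_frequently_mem_window`).

Transfer: nested word intervals determine a point of the circle. By unique ergodicity this
projection carries `μ` to Lebesgue measure, and almost every sequence is the itinerary of its image.
-/

theorem exists_int_contsAux (v : ℝ) (n : ℕ) :
    (∃ a : ℤ, ((GenContFract.of v).contsAux n).a = a) ∧
      ∃ b : ℤ, ((GenContFract.of v).contsAux n).b = b := by
  induction n using Nat.strong_induction_on with
  | _ n ih =>
    match n with
    | 0 => exact ⟨⟨1, by simp⟩, ⟨0, by simp⟩⟩
    | 1 => exact ⟨⟨⌊v⌋, by simp [GenContFract.of_h_eq_floor]⟩, ⟨1, by simp⟩⟩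
    | n + 2 =>
      obtain ⟨⟨a₀, ha₀⟩, b₀, hb₀⟩ := ih n (by omega)
      obtain ⟨⟨a₁, ha₁⟩, b₁, hb₁⟩ := ih (n + 1) (by omega)
      rcases hs : (GenContFract.of v).s.get? n with _ | gp
      · have : (GenContFract.of v).contsAux (n + 2) = (GenContFract.of v).contsAux (n + 1) :=
          GenContFract.contsAux_stable_step_of_terminated hs
        rw [this]
        exact ⟨⟨a₁, ha₁⟩, b₁, hb₁⟩
      · obtain ⟨h1, z, hz⟩ := GenContFract.of_partNum_eq_one_and_exists_int_partDen_eq hs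
        rw [GenContFract.contsAux_recurrence hs rfl rfl]
        refine ⟨⟨z * a₁ + a₀, ?_⟩, ⟨z * b₁ + b₀, ?_⟩⟩
        · simp [h1, hz, ha₀, ha₁]
        · simp [h1, hz, hb₀, hb₁]

/-- The `n`-th convergent `A/B` works: its error is at most one over the product of consecutive
denominators, and the next denominator is at least `b * B`. Reducing the fraction only shrinks the
denominator. -/
theorem exists_rat_approx_of_partDen {v b : ℝ} {n : ℕ}
    (hb : (GenContFract.of v).partDens.get? n = some b) :
    ∃ r : ℚ, (r.den : ℝ) ^ 2 * |v - r| ≤ 1 / b := by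
  have hnt : ¬ (GenContFract.of v).TerminatedAt n := by
    rw [GenContFract.terminatedAt_iff_partDen_none, hb]
    simp
  have hb1 : 1 ≤ b := GenContFract.of_one_le_get?_partDen hb
  have hB : (1 : ℝ) ≤ (GenContFract.of v).dens n := by
    refine le_trans ?_ (GenContFract.succ_nth_fib_le_of_nth_den
      (Or.inr (mt (GenContFract.terminated_stable n.pred_le) hnt)))
    exact_mod_cast Nat.fib_pos.2 n.succ_pos
  have hle := GenContFract.le_of_succ_get?_den hb
  have happ := GenContFract.abs_sub_convs_le hnt
  obtain ⟨⟨A, hA⟩, B, hBz⟩ := exists_int_contsAux v (n + 1)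
  have hA' : (GenContFract.of v).nums n = A := hA
  have hB' : (GenContFract.of v).dens n = B := hBz
  have hBpos : (0 : ℤ) < B := by
    rw [hB'] at hB
    exact_mod_cast lt_of_lt_of_le one_pos hB
  have hconv : (GenContFract.of v).convs n = ((A / B : ℚ) : ℝ) := by
    rw [GenContFract.conv_eq_num_div_den, hA', hB']
    push_cast
    rfl
  refine ⟨(A / B : ℚ), ?_⟩
  rw [hconv] at happ
  have hden : (((A / B : ℚ).den : ℕ) : ℝ) ≤ B := by
    have h := Rat.den_dvd A B
    exact_mod_cast Int.le_of_dvd hBpos h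
  rw [hB'] at hle happ hB
  calc _ ≤ (B : ℝ) ^ 2 * (1 / (B * (GenContFract.of v).dens (n + 1))) := by gcongr
    _ ≤ (B : ℝ) ^ 2 * (1 / (B * (b * B))) := by gcongr
    _ = 1 / b := by field_simp

/-- Only finitely many denominators occur, and irrationality keeps each error positive. Hence very
good approximations must have large denominators. -/
theorem exists_pos_le_den_mul_abs {α : ℝ} (hα : Irrational α) (N : ℕ) :
    ∃ ε > 0, ∀ r : ℚ, r.den ≤ N → ε ≤ (r.den : ℝ) ^ 2 * |α - r| := by
  have key : ∀ q : ℕ, 0 < q → 0 < (q : ℝ) * |q * α - round (q * α)| := by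
    intro q hq
    have : (q : ℝ) * α - round (q * α) ≠ 0 :=
      ((hα.natCast_mul hq.ne').sub_intCast _).ne_zero
    positivity
  have hfin : ∃ ε > 0, ∀ q : ℕ, 0 < q → q ≤ N → ε ≤ (q : ℝ) * |q * α - round (q * α)| := by
    induction N with
    | zero => exact ⟨1, one_pos, fun q h h' => by omega⟩
    | succ N ih =>
      obtain ⟨ε, hε, h⟩ := ih
      refine ⟨min ε (((N + 1 : ℕ) : ℝ) * |(N + 1 : ℕ) * α - round ((N + 1 : ℕ) * α)|),
        lt_min hε (key _ N.succ_pos), fun q hq hqN => ?_⟩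
      rcases Nat.lt_or_ge N q with h1 | h1
      · obtain rfl : q = N + 1 := by omega
        exact min_le_right _ _
      · exact (min_le_left _ _).trans (h q hq h1)
  obtain ⟨ε, hε, h⟩ := hfin
  refine ⟨ε, hε, fun r hr => (h r.den r.pos hr).trans ?_⟩
  have hd : (0 : ℝ) < r.den := by exact_mod_cast r.pos
  have e : (r.den : ℝ) ^ 2 * |α - r| = r.den * |r.den * α - r.num| := by
    rw [pow_two, mul_assoc, ← abs_of_pos hd, ← abs_mul, abs_of_pos hd, mul_sub]
    congr 3
    rw [mul_comm]
    exact_mod_cast Rat.mul_den_eq_num r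
  rw [e]
  exact mul_le_mul_of_nonneg_left (round_le ((r.den : ℝ) * α) r.num) hd.le

theorem UnboundedPartialQuotients.exists_rat {α : ℝ} (h : UnboundedPartialQuotients α)
    (hα : Irrational α) (N : ℕ) {ε : ℝ} (hε : 0 < ε) :
    ∃ r : ℚ, N < r.den ∧ (r.den : ℝ) ^ 2 * |α - r| < ε := by
  obtain ⟨δ, hδ, hN⟩ := exists_pos_le_den_mul_abs hα N
  obtain ⟨b, ⟨n, hn⟩, hb⟩ := not_bddAbove_iff.1 h (1 / min ε δ)
  have hm : 0 < min ε δ := lt_min hε hδ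
  obtain ⟨r, hr⟩ := exists_rat_approx_of_partDen hn
  have hlt : (r.den : ℝ) ^ 2 * |α - r| < min ε δ := by
    refine hr.trans_lt ?_
    rw [one_div_lt (lt_trans (by positivity) hb) hm]
    exact hb
  refine ⟨r, ?_, hlt.trans_le (min_le_left _ _)⟩
  by_contra hc
  exact absurd (hN r (not_lt.1 hc)) (not_le.2 (hlt.trans_le (min_le_right _ _)))

/-- The signed error `q α - p` of the approximation of `α` by the reduced fraction `p / q`. -/
noncomputable def approxError (α : ℝ) (r : ℚ) : ℝ := r.den * α - r.num

theorem approxError_ne_zero {α : ℝ} (hα : Irrational α) (r : ℚ) : approxError α r ≠ 0 :=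
  ((hα.natCast_mul r.den_ne_zero).sub_intCast _).ne_zero

theorem den_mul_abs_approxError (α : ℝ) (r : ℚ) :
    (r.den : ℝ) * |approxError α r| = (r.den : ℝ) ^ 2 * |α - r| := by
  have hd : (0 : ℝ) < r.den := by exact_mod_cast r.pos
  have : approxError α r = r.den * (α - r) := by
    rw [approxError, mul_sub]
    congr 1
    rw [mul_comm]
    exact_mod_cast (Rat.mul_den_eq_num r).symm
  rw [this, abs_mul, abs_of_pos hd]
  ring

/-- With `r = p/q`, the integer `ql - kp` equals `kδ - q(kα - l)`. It is nonzero, for otherwise `(k,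
l)` would be a nonzero multiple of `(q, p)` and its error at least `|δ|`. -/
theorem one_le_of_abs_lt_approxError {α : ℝ} {r : ℚ} {k : ℕ} (hk : 0 < k) {l : ℤ}
    (h : |k * α - l| < |approxError α r|) : 1 ≤ (k + r.den) * |approxError α r| := by
  have hd : (0 : ℝ) < r.den := by exact_mod_cast r.pos
  have hk' : (0 : ℝ) < k := by exact_mod_cast hk
  have hne : (r.den : ℤ) * l - k * r.num ≠ 0 := by
    intro h0
    have hdvd : (r.den : ℤ) ∣ k := by
      have h1 : (r.den : ℤ) ∣ k * r.num := ⟨l, by linarith⟩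
      refine IsCoprime.dvd_of_dvd_mul_right ?_ h1
      have := r.reduced
      rw [Int.isCoprime_iff_nat_coprime]
      simpa using this.symm
    obtain ⟨c, hc⟩ := hdvd
    have hl : l = c * r.num := by
      have : (r.den : ℤ) * l = r.den * (c * r.num) := by rw [hc] at h0; linarith
      exact mul_left_cancel₀ (by exact_mod_cast r.den_ne_zero) this
    have hc1 : 1 ≤ |(c : ℝ)| := by
      have : c ≠ 0 := by
        rintro rfl
        simp at hc
        omega
      exact_mod_cast Int.one_le_abs this
    have hk2 : (k : ℝ) = r.den * c := by exact_mod_cast hc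
    have : (k : ℝ) * α - l = c * approxError α r := by
      rw [approxError, hk2, hl]
      push_cast
      ring
    rw [this, abs_mul] at h
    nlinarith [abs_nonneg (approxError α r)]
  have h1 : (1 : ℝ) ≤ |(((r.den : ℤ) * l - k * r.num : ℤ) : ℝ)| := by
    exact_mod_cast Int.one_le_abs hne
  have h2 : (((r.den : ℤ) * l - k * r.num : ℤ) : ℝ)
      = k * approxError α r - r.den * (k * α - l) := by
    rw [approxError]
    push_cast
    ring
  rw [h2] at h1
  have h3 := h1.trans (abs_sub _ _)
  rw [abs_mul, abs_mul, abs_of_pos hd, abs_of_pos hk'] at h3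
  nlinarith

/-- If `q |q α - p| ≤ 1 / 2`, then every `k > 0` for which `k α` is closer to an integer than
`q α` to `p` satisfies `k ≥ 1 / (2 |q α - p|)`. -/
theorem one_le_two_mul_of_abs_lt_approxError {α : ℝ} {r : ℚ}
    (hr : (r.den : ℝ) * |approxError α r| ≤ 1 / 2) {k : ℕ} (hk : 0 < k) {l : ℤ}
    (h : |k * α - l| < |approxError α r|) : 1 ≤ 2 * k * |approxError α r| := by
  have := one_le_of_abs_lt_approxError hk h
  linarith

/-! ### Iterates of the rotation -/

theorem rotation_iterate (α t : ℝ) (ht : t ∈ Set.Ico (0 : ℝ) 1) (k : ℕ) :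
    (rotation α)^[k] t = Int.fract (t + k * α) := by
  induction k with
  | zero => simpa using (Int.fract_eq_self.2 ht).symm
  | succ k ih =>
    rw [Function.iterate_succ_apply', ih, rotation, Int.fract_eq_fract]
    refine ⟨-⌊t + k * α⌋, ?_⟩
    rw [← Int.self_sub_floor (t + k * α)]
    push_cast
    ring

theorem fract_mem_Ico (x : ℝ) : Int.fract x ∈ Set.Ico (0 : ℝ) 1 :=
  ⟨Int.fract_nonneg x, Int.fract_lt_one x⟩

theorem rotation_iterate_mem {α t : ℝ} (ht : t ∈ Set.Ico (0 : ℝ) 1) (k : ℕ) :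
    (rotation α)^[k] t ∈ Set.Ico (0 : ℝ) 1 := by
  rw [rotation_iterate α t ht]
  exact fract_mem_Ico _

/-- The displacement of the rotation on the letter interval of `a`. -/
def displacement (α : ℝ) (a : Fin 2) : ℝ := if a = 0 then α else α - 1

theorem rotation_eq_add_displacement {α : ℝ} (hα0 : 0 < α) (hα1 : α < 1) {a : Fin 2} {t : ℝ}
    (ht : t ∈ letterInterval α a) : rotation α t = t + displacement α a := by
  unfold letterInterval at ht
  unfold rotation displacement
  split_ifs at ht ⊢
  · exact Int.fract_eq_self.2 ⟨by linarith [ht.1], by linarith [ht.2]⟩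
  · rw [Int.fract_eq_iff]
    exact ⟨by linarith [ht.1], by linarith [ht.2], 1, by push_cast; ring⟩

/-- On the interval of a word of length `n`, the iterates up to `n` are translations. -/
theorem rotation_iterate_eq_add_sum {α : ℝ} (hα0 : 0 < α) (hα1 : α < 1) {x : ℕ → Fin 2} {n : ℕ}
    {t : ℝ} (ht : t ∈ wordInterval α (pref x n)) {k : ℕ} (hk : k ≤ n) :
    (rotation α)^[k] t = t + ∑ i ∈ Finset.range k, displacement α (x i) := by
  induction k with
  | zero => simp
  | succ k ih =>
    have h := ht.2 ⟨k, hk⟩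
    rw [Function.iterate_succ_apply', rotation_eq_add_displacement hα0 hα1 h, ih (by omega),
      Finset.sum_range_succ, add_assoc]
    rfl

theorem letterInterval_ordConnected (α : ℝ) (a : Fin 2) : (letterInterval α a).OrdConnected := by
  unfold letterInterval
  split_ifs <;> exact Set.ordConnected_Ico

/-- As long as an intermediate point shares the first `k` letters, its `k`-th iterate is the same
translate as those of the two outer points, hence lies between them in the same letter interval. -/
theorem wordInterval_ordConnected {α : ℝ} (hα0 : 0 < α) (hα1 : α < 1) (x : ℕ → Fin 2) (n : ℕ) :
    (wordInterval α (pref x n)).OrdConnected := by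
  refine ⟨fun s hs t ht r hr => ?_⟩
  have hr01 : r ∈ Set.Ico (0 : ℝ) 1 := ⟨hs.1.1.trans hr.1, hr.2.trans_lt ht.1.2⟩
  have key : ∀ k ≤ n, r ∈ wordInterval α (pref x k) := by
    intro k
    induction k with
    | zero => exact fun _ => ⟨hr01, fun i => i.elim0⟩
    | succ k ih =>
      intro hk
      have ihk := ih (by omega)
      refine ⟨hr01, fun i => ?_⟩
      rcases Nat.lt_succ_iff_lt_or_eq.1 i.2 with hi | hi
      · exact ihk.2 ⟨i, hi⟩
      · have h1 := hs.2 ⟨k, hk⟩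
        have h2 := ht.2 ⟨k, hk⟩
        dsimp only [pref] at h1 h2 ⊢
        rw [hi]
        rw [rotation_iterate_eq_add_sum hα0 hα1 hs (by omega)] at h1
        rw [rotation_iterate_eq_add_sum hα0 hα1 ht (by omega)] at h2
        rw [rotation_iterate_eq_add_sum hα0 hα1 ihk le_rfl]
        exact (letterInterval_ordConnected α _).out h1 h2
          ⟨by linarith [hr.1], by linarith [hr.2]⟩
  exact key n le_rfl

theorem wordInterval_anti {α : ℝ} (x : ℕ → Fin 2) {m n : ℕ} (h : m ≤ n) :
    wordInterval α (pref x n) ⊆ wordInterval α (pref x m) :=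
  fun _ ht => ⟨ht.1, fun k => ht.2 ⟨k, k.2.trans_le h⟩⟩

/-! ### Return times of cylinders -/

/-- The sequence `x` is the itinerary of the point `t` of the circle. -/
def IsItinerary (α : ℝ) (x : ℕ → Fin 2) (t : ℝ) : Prop :=
  t ∈ Set.Ico (0 : ℝ) 1 ∧ ∀ k, (rotation α)^[k] t ∈ letterInterval α (x k)

theorem IsItinerary.mem_wordInterval {α t : ℝ} {x : ℕ → Fin 2} (h : IsItinerary α x t) (n : ℕ) :
    t ∈ wordInterval α (pref x n) :=
  ⟨h.1, fun k => h.2 k⟩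

theorem sturmianMap_iterate_apply {α : ℝ} (x : sturmianShift α) (k i : ℕ) :
    ((sturmianMap α)^[k] x : ℕ → Fin 2) i = (x : ℕ → Fin 2) (i + k) := by
  induction k generalizing x with
  | zero => rfl
  | succ k ih =>
    rw [Function.iterate_succ_apply, ih]
    change (x : ℕ → Fin 2) (i + k + 1) = _
    rfl

theorem returnTime_cylinder_le {α : ℝ} (x : sturmianShift α) {n q : ℕ} (hq : 0 < q)
    (h : ∀ j < n, (x : ℕ → Fin 2) (j + q) = (x : ℕ → Fin 2) j) :
    returnTime (sturmianMap α) (cylinder (sturmianShift α) (pref (x : ℕ → Fin 2) n)) ≤ q := by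
  refine iInf₂_le q ⟨hq, (sturmianMap α)^[q] x, ⟨x, fun i => rfl, rfl⟩, fun i => ?_⟩
  rw [sturmianMap_iterate_apply]
  exact h i i.2

theorem IsItinerary.apply_add_eq {α t : ℝ} (hα0 : 0 < α) (hα1 : α < 1) {x : ℕ → Fin 2}
    (h : IsItinerary α x t) {r : ℚ} {n : ℕ}
    (hn : ∀ j ≤ n, (rotation α)^[j] t + approxError α r ∈ Set.Ico (0 : ℝ) 1) {j : ℕ}
    (hj : j < n) : x (j + r.den) = x j := by
  have e : (rotation α)^[j + r.den] t = (rotation α)^[j] t + approxError α r := by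
    rw [← Int.fract_eq_self.2 (hn j hj.le), rotation_iterate α t h.1, rotation_iterate α t h.1,
      Int.fract_eq_fract]
    refine ⟨⌊t + j * α⌋ + r.num, ?_⟩
    rw [← Int.self_sub_floor (t + j * α), approxError]
    push_cast
    ring
  have h1 := h.2 j
  have h2 := h.2 (j + r.den)
  -- Displacements of different letters differ by 1, so a change of letter would push the translate
  -- at time `j + 1` out of `[0, 1)`.
  have h3 := hn (j + 1) hj
  rw [Function.iterate_succ_apply', rotation_eq_add_displacement hα0 hα1 h1] at h3
  rw [e] at h2
  obtain ⟨h4, h5⟩ := h3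
  have two : ∀ a : Fin 2, a = 0 ∨ a = 1 := by decide
  rcases two (x j) with h0 | h0 <;> rcases two (x (j + r.den)) with h0' | h0' <;>
    simp only [h0, h0'] <;>
    simp only [h0, h0', letterInterval, displacement, if_true, one_ne_zero, if_false] at h1 h2 h4 h5
  · linarith [h2.1]
  · linarith [h2.2]

theorem abs_sub_lt_of_sub_notMem_Ico {β y z : ℝ} (hy : y ∈ Set.Ico (0 : ℝ) 1)
    (hz : z ∈ Set.Ico (0 : ℝ) 1) (hyβ : y - β ∉ Set.Ico (0 : ℝ) 1)
    (hzβ : z - β ∉ Set.Ico (0 : ℝ) 1) : |y - z| < |β| := by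
  simp only [Set.mem_Ico, not_and_or, not_le, not_lt] at *
  rw [abs_lt]
  rcases le_total 0 β with h | h
  · rw [abs_of_nonneg h]
    rcases hyβ with h1 | h1 <;> rcases hzβ with h2 | h2 <;> constructor <;> linarith
  · rw [abs_of_nonpos h]
    rcases hyβ with h1 | h1 <;> rcases hzβ with h2 | h2 <;> constructor <;> linarith

/-- The integer `m` in `R^n = R^(n-q) + δ + m` is constant on the word interval, and the `n`-th
iterate is in the window exactly when `m ≠ 0`. -/
theorem rotation_iterate_sub_notMem_Ico {α s t : ℝ} (hα0 : 0 < α) (hα1 : α < 1) {x : ℕ → Fin 2}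
    {n : ℕ} (hs : s ∈ wordInterval α (pref x n)) (ht : t ∈ wordInterval α (pref x n)) {r : ℚ}
    (hr : r.den ≤ n) (h : (rotation α)^[n] t - approxError α r ∉ Set.Ico (0 : ℝ) 1) :
    (rotation α)^[n] s - approxError α r ∉ Set.Ico (0 : ℝ) 1 := by
  have h1 := rotation_iterate_mem (α := α) ht.1 (n - r.den)
  have h2 := rotation_iterate_mem (α := α) hs.1 (n - r.den)
  obtain ⟨m, hm⟩ : ∃ m : ℤ, (rotation α)^[n] t
      = (rotation α)^[n - r.den] t + approxError α r + m := by
    refine ⟨⌊t + ((n - r.den : ℕ) : ℝ) * α⌋ - ⌊t + n * α⌋ + r.num, ?_⟩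
    rw [rotation_iterate α t ht.1, rotation_iterate α t ht.1, ← Int.self_sub_floor,
      ← Int.self_sub_floor, approxError]
    push_cast [hr]
    ring
  have hm' : (rotation α)^[n] s = (rotation α)^[n - r.den] s + approxError α r + m := by
    rw [rotation_iterate_eq_add_sum hα0 hα1 hs le_rfl,
      rotation_iterate_eq_add_sum hα0 hα1 hs (Nat.sub_le _ _)]
    rw [rotation_iterate_eq_add_sum hα0 hα1 ht le_rfl,
      rotation_iterate_eq_add_sum hα0 hα1 ht (Nat.sub_le _ _)] at hm
    linarith
  have hm0 : m ≠ 0 := by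
    rintro rfl
    apply h
    rw [hm]
    simpa using h1
  rw [hm']
  rintro ⟨h3, h4⟩
  rcases lt_or_gt_of_ne hm0 with h0 | h0
  · have : (m : ℝ) ≤ -1 := by exact_mod_cast Int.le_sub_one_of_lt h0
    linarith [h2.2]
  · have : (1 : ℝ) ≤ m := by exact_mod_cast h0
    linarith [h2.1]

/-- A point `s` realizing the first `n + k` letters of a returning sequence has both `s` and `R^k s`
in the interval of `x(n)`, so `R^n s` and `R^(n+k) s` share a window of length `|δ|`. -/
theorem exists_abs_sub_lt_of_return {α t : ℝ} (hα0 : 0 < α) (hα1 : α < 1) (x : sturmianShift α)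
    {n : ℕ} (ht : t ∈ wordInterval α (pref (x : ℕ → Fin 2) n)) {r : ℚ} (hr : r.den ≤ n)
    (h : (rotation α)^[n] t - approxError α r ∉ Set.Ico (0 : ℝ) 1) {k : ℕ}
    (hk : (((sturmianMap α)^[k] '' cylinder (sturmianShift α) (pref (x : ℕ → Fin 2) n)) ∩
      cylinder (sturmianShift α) (pref (x : ℕ → Fin 2) n)).Nonempty) :
    ∃ l : ℤ, |k * α - l| < |approxError α r| := by
  obtain ⟨-, ⟨y, hy, rfl⟩, hy'⟩ := hk
  obtain ⟨s, hs⟩ := y.2 (n + k)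
  have hs1 : s ∈ wordInterval α (pref (x : ℕ → Fin 2) n) := by
    refine ⟨hs.1, fun i => ?_⟩
    rw [← hy i]
    exact hs.2 ⟨i, by omega⟩
  have hs2 : (rotation α)^[k] s ∈ wordInterval α (pref (x : ℕ → Fin 2) n) := by
    refine ⟨rotation_iterate_mem hs.1 k, fun i => ?_⟩
    rw [← hy' i, sturmianMap_iterate_apply, ← Function.iterate_add_apply]
    exact hs.2 ⟨i + k, by omega⟩
  have h1 := rotation_iterate_sub_notMem_Ico hα0 hα1 hs1 ht hr h
  have h2 := rotation_iterate_sub_notMem_Ico hα0 hα1 hs2 ht hr h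
  have h3 := abs_sub_lt_of_sub_notMem_Ico (rotation_iterate_mem hs2.1 n)
    (rotation_iterate_mem hs1.1 n) h2 h1
  rw [← Function.iterate_add_apply, rotation_iterate α s hs.1, rotation_iterate α s hs.1,
    ← Int.self_sub_floor, ← Int.self_sub_floor] at h3
  refine ⟨⌊s + ((n + k : ℕ) : ℝ) * α⌋ - ⌊s + n * α⌋, ?_⟩
  convert h3 using 2
  push_cast
  ring

theorem mul_le_returnTime_cylinder {α t : ℝ} (hα : Irrational α) (hα0 : 0 < α) (hα1 : α < 1)
    (x : sturmianShift α) {n K : ℕ} (ht : t ∈ wordInterval α (pref (x : ℕ → Fin 2) n)) {r : ℚ}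
    (hr : r.den ≤ n) (hr2 : (r.den : ℝ) * |approxError α r| ≤ 1 / 2)
    (hK : 2 * (K * n : ℝ) * |approxError α r| ≤ 1)
    (h : (rotation α)^[n] t - approxError α r ∉ Set.Ico (0 : ℝ) 1) :
    ((K * n : ℕ) : ℕ∞) ≤
      returnTime (sturmianMap α) (cylinder (sturmianShift α) (pref (x : ℕ → Fin 2) n)) := by
  refine le_iInf₂ fun k hk => ?_
  obtain ⟨l, hl⟩ := exists_abs_sub_lt_of_return hα0 hα1 x ht hr h hk.2
  have h1 := hK.trans (one_le_two_mul_of_abs_lt_approxError hr2 hk.1 hl)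
  have h2 : 0 < |approxError α r| := abs_pos.2 (approxError_ne_zero hα r)
  have h3 : (K * n : ℝ) ≤ k := by
    have := le_of_mul_le_mul_right h1 h2
    linarith
  exact_mod_cast h3

theorem lowerReturnRate_eq_zero {A : Type*} {S : Set (ℕ → A)} {F : S → S} {x : S}
    (h : ∀ m : ℕ, ∃ᶠ n in atTop,
      (m : ℕ∞) * returnTime F (cylinder S (pref (x : ℕ → A) n)) ≤ n) :
    lowerReturnRate S F x = 0 := by
  refine le_antisymm (ENNReal.le_of_forall_pos_le_add fun ε hε _ => ?_) bot_le
  rw [zero_add]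
  obtain ⟨m, hm⟩ := ENNReal.exists_inv_nat_lt (a := (ε : ℝ≥0∞)) (by simpa using hε.ne')
  refine le_trans (liminf_le_of_frequently_le ((h m).mono fun n hn => ?_)) hm.le
  have hn' : (m : ℝ≥0∞) * (returnTime F (cylinder S (pref (x : ℕ → A) n)) : ℝ≥0∞) ≤ n := by
    exact_mod_cast hn
  have hm0 : (m : ℝ≥0∞) ≠ 0 := by
    rintro h0
    simp [h0] at hm
  refine ENNReal.div_le_of_le_mul ?_
  calc _ = (m : ℝ≥0∞)⁻¹ * (m * (returnTime F (cylinder S (pref (x : ℕ → A) n)) : ℝ≥0∞)) := by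
        rw [← mul_assoc, ENNReal.inv_mul_cancel hm0 (ENNReal.natCast_ne_top m), one_mul]
    _ ≤ _ := by gcongr

theorem upperReturnRate_eq_top {A : Type*} {S : Set (ℕ → A)} {F : S → S} {x : S}
    (h : ∀ K : ℕ, ∃ᶠ n in atTop,
      ((K * n : ℕ) : ℕ∞) ≤ returnTime F (cylinder S (pref (x : ℕ → A) n))) :
    upperReturnRate S F x = ⊤ := by
  refine ENNReal.eq_top_of_forall_nnreal_le fun a => ?_
  obtain ⟨K, hK⟩ := exists_nat_ge a
  refine le_trans (b := (K : ℝ≥0∞)) (by exact_mod_cast hK) ?_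
  refine le_limsup_of_frequently_le
    (((h K).and_eventually (eventually_gt_atTop 0)).mono fun n hn => ?_)
  have hn' : ((K * n : ℕ) : ℝ≥0∞) ≤
      (returnTime F (cylinder S (pref (x : ℕ → A) n)) : ℝ≥0∞) := by
    exact_mod_cast hn.1
  rw [ENNReal.le_div_iff_mul_le (Or.inl (by simpa using hn.2.ne'))
    (Or.inl (ENNReal.natCast_ne_top n))]
  exact_mod_cast hn'

/-! ### The circle -/

/-- The representative in `[0, 1)` of a point of the circle. -/
noncomputable def circleRep (t : UnitAddCircle) : ℝ := AddCircle.equivIco 1 0 t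

theorem circleRep_mem (t : UnitAddCircle) : circleRep t ∈ Set.Ico (0 : ℝ) 1 := by
  have h := (AddCircle.equivIco 1 0 t).2
  exact ⟨h.1, h.2.trans_eq (zero_add 1)⟩

theorem coe_circleRep (t : UnitAddCircle) : (circleRep t : UnitAddCircle) = t :=
  AddCircle.coe_equivIco

theorem circleRep_coe (x : ℝ) : circleRep (x : UnitAddCircle) = Int.fract x := by
  have := AddCircle.coe_equivIco_mk_apply (1 : ℝ) x
  rwa [div_one, mul_one] at this

theorem circleRep_add_coe (t : UnitAddCircle) (x : ℝ) :
    circleRep (t + x) = Int.fract (circleRep t + x) := by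
  conv_lhs => rw [← coe_circleRep t]
  rw [← AddCircle.coe_add, circleRep_coe]

theorem circleRep_add_mul (α : ℝ) (t : UnitAddCircle) (k : ℕ) :
    circleRep (t + ((k * α : ℝ) : UnitAddCircle)) = (rotation α)^[k] (circleRep t) := by
  rw [circleRep_add_coe, rotation_iterate α _ (circleRep_mem t)]

theorem measurable_circleRep : Measurable circleRep :=
  measurable_subtype_coe.comp (AddCircle.measurableEquivIco 1 0).measurable

theorem volume_circleRep_preimage {S : Set ℝ} (hS : MeasurableSet S) :
    volume (circleRep ⁻¹' S) = volume (S ∩ Set.Ico 0 1) := by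
  have h := (UnitAddCircle.measurePreserving_mk 0).measure_preimage
    (measurable_circleRep hS).nullMeasurableSet
  rw [← h, zero_add, ← Measure.restrict_congr_set Ico_ae_eq_Ioc, Measure.restrict_apply']
  · congr 1
    ext x
    simp only [Set.mem_inter_iff, Set.mem_preimage, and_congr_left_iff]
    intro hx
    have : circleRep (x : UnitAddCircle) = x := by rw [circleRep_coe, Int.fract_eq_self.2 hx]
    change circleRep (x : UnitAddCircle) ∈ S ↔ _
    rw [this]
  · exact measurableSet_Ico

/-- The arc of the points which the translation by `-β` moves across `0`. -/
def window (β : ℝ) : Set UnitAddCircle := {t | circleRep t - β ∉ Set.Ico (0 : ℝ) 1}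

theorem measurableSet_window (β : ℝ) : MeasurableSet (window β) :=
  ((measurable_circleRep.sub_const β) measurableSet_Ico).compl

theorem volume_window {β : ℝ} (hβ : |β| ≤ 1) : volume (window β) = ENNReal.ofReal |β| := by
  have h : window β = circleRep ⁻¹' {y | y - β ∉ Set.Ico (0 : ℝ) 1} := rfl
  have hm : MeasurableSet {y : ℝ | y - β ∉ Set.Ico (0 : ℝ) 1} :=
    ((measurable_id.sub_const β) measurableSet_Ico).compl
  rw [h, volume_circleRep_preimage hm]
  obtain ⟨h1, h2⟩ := abs_le.1 hβ
  rcases le_total 0 β with h0 | h0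
  · have : {y : ℝ | y - β ∉ Set.Ico (0 : ℝ) 1} ∩ Set.Ico 0 1 = Set.Ico 0 β := by
      ext y
      simp only [Set.mem_inter_iff, Set.mem_ofPred_eq, Set.mem_Ico, not_and_or, not_le, not_lt]
      constructor
      · rintro ⟨h3 | h3, h4, h5⟩ <;> constructor <;> linarith
      · rintro ⟨h3, h4⟩
        exact ⟨Or.inl (by linarith), h3, by linarith⟩
    rw [this, Real.volume_Ico, abs_of_nonneg h0, sub_zero]
  · have : {y : ℝ | y - β ∉ Set.Ico (0 : ℝ) 1} ∩ Set.Ico 0 1 = Set.Ico (1 + β) 1 := by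
      ext y
      simp only [Set.mem_inter_iff, Set.mem_ofPred_eq, Set.mem_Ico, not_and_or, not_le, not_lt]
      constructor
      · rintro ⟨h3 | h3, h4, h5⟩ <;> constructor <;> linarith
      · rintro ⟨h3, h4⟩
        exact ⟨Or.inr (by linarith), by linarith, h4⟩
    rw [this, Real.volume_Ico, abs_of_nonpos h0]
    congr 1
    ring

/-- The points of the circle which the `i`-th iterate of the rotation maps to the window of `β`. -/
def hitting (α β : ℝ) (i : ℕ) : Set UnitAddCircle :=
  {t | t + ((i * α : ℝ) : UnitAddCircle) ∈ window β}

theorem mem_hitting {α β : ℝ} {i : ℕ} {t : UnitAddCircle} :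
    t ∈ hitting α β i ↔ (rotation α)^[i] (circleRep t) - β ∉ Set.Ico (0 : ℝ) 1 := by
  rw [← circleRep_add_mul]
  rfl

theorem measurableSet_hitting (α β : ℝ) (i : ℕ) : MeasurableSet (hitting α β i) :=
  (measurable_add_const _) (measurableSet_window β)

theorem volume_hitting (α : ℝ) {β : ℝ} (hβ : |β| ≤ 1) (i : ℕ) :
    volume (hitting α β i) = ENNReal.ofReal |β| := by
  rw [← volume_window hβ]
  exact measure_preimage_add_right volume _ _

/-! ### Borel–Cantelli: long almost-periods along almost every orbit. -/

/-- Reduced fractions with denominators tending to infinity and fast decaying errors. -/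
theorem exists_approx_seq {α : ℝ} (hα : Irrational α) (h : UnboundedPartialQuotients α) :
    ∃ r : ℕ → ℚ, ∀ j, j < (r j).den ∧
      ((r j).den : ℝ) * |approxError α (r j)| < (1 / 2) ^ (j + 1) := by
  choose r hr using fun j : ℕ => h.exists_rat hα j (ε := (1 / 2) ^ (j + 1)) (by positivity)
  exact ⟨r, fun j => ⟨(hr j).1, by rw [den_mul_abs_approxError]; exact (hr j).2⟩⟩

theorem abs_approxError_le_one {α : ℝ} {r : ℚ} (h : (r.den : ℝ) * |approxError α r| ≤ 1) :
    |approxError α r| ≤ 1 := by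
  have : (1 : ℝ) ≤ r.den := by exact_mod_cast r.pos
  nlinarith [abs_nonneg (approxError α r)]

theorem ae_frequently_recurrent {α : ℝ} (hα : Irrational α) (h : UnboundedPartialQuotients α)
    (m : ℕ) : ∀ᵐ t : UnitAddCircle, ∃ᶠ n : ℕ in atTop, ∃ r : ℚ, m * r.den ≤ n ∧
      ∀ j ≤ n, (rotation α)^[j] (circleRep t) + approxError α r ∈ Set.Ico (0 : ℝ) 1 := by
  obtain ⟨r, hr⟩ := exists_approx_seq hα h
  have hpow : ∀ j : ℕ, ((1 : ℝ) / 2) ^ (j + 1) ≤ 1 := fun j => pow_le_one₀ (by norm_num) (by norm_num)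
  -- The factor `m + 1` makes `N` tend to infinity even when `m = 0`.
  set N : ℕ → ℕ := fun j => (m + 1) * (r j).den with hN
  set B : ℕ → Set UnitAddCircle := fun j =>
    ⋃ i ∈ Finset.range (N j + 1), hitting α (-approxError α (r j)) i
  have hvol : ∀ j, volume (B j) ≤ ENNReal.ofReal ((m + 2) * (1 / 2) ^ (j + 1)) := by
    intro j
    have hle : |-approxError α (r j)| ≤ 1 := by
      rw [abs_neg]
      exact abs_approxError_le_one ((hr j).2.le.trans (hpow j))
    refine (measure_biUnion_finset_le _ _).trans ?_
    simp only [volume_hitting α hle, Finset.sum_const, Finset.card_range, nsmul_eq_mul]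
    rw [← ENNReal.ofReal_natCast, ← ENNReal.ofReal_mul (Nat.cast_nonneg _), abs_neg]
    apply ENNReal.ofReal_le_ofReal
    have h1 : ((N j + 1 : ℕ) : ℝ) ≤ (m + 2) * (r j).den := by
      have : (1 : ℝ) ≤ (r j).den := by exact_mod_cast (r j).pos
      simp only [hN]
      push_cast
      linarith
    calc _ ≤ ((m + 2) * (r j).den) * |approxError α (r j)| := by gcongr
      _ = (m + 2) * ((r j).den * |approxError α (r j)|) := by ring
      _ ≤ _ := by gcongr; exact (hr j).2.le
  have hsum : ∑' j, volume (B j) ≠ ⊤ := by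
    refine ne_top_of_le_ne_top ?_ (ENNReal.tsum_le_tsum hvol)
    have hs : Summable fun j : ℕ => ((m : ℝ) + 2) * (1 / 2) ^ (j + 1) := by
      refine Summable.mul_left _ ?_
      simpa [pow_succ] using (summable_geometric_two).mul_right (1 / 2 : ℝ)
    rw [← ENNReal.ofReal_tsum_of_nonneg (fun j => by positivity) hs]
    exact ENNReal.ofReal_ne_top
  filter_upwards [ae_eventually_notMem hsum] with t ht
  have hNt : Tendsto N atTop atTop := by
    refine tendsto_atTop_mono (fun j => ?_) tendsto_id
    simp only [hN, id]
    nlinarith [(hr j).1]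
  refine hNt.frequently (ht.mono fun j hj => ?_).frequently
  refine ⟨r j, Nat.mul_le_mul_right _ m.le_succ, fun i hi => ?_⟩
  by_contra hc
  refine hj (Set.mem_biUnion (Finset.mem_coe.2 (Finset.mem_range.2 (Nat.lt_succ_of_le hi))) ?_)
  rw [mem_hitting, sub_neg_eq_add]
  exact hc

/-! ### Ergodicity: late hits of small windows. -/

theorem le_measure_setOf_frequently {Ω : Type*} [MeasurableSpace Ω] {μ : Measure Ω}
    [IsFiniteMeasure μ] {A : ℕ → Set Ω} (hA : ∀ j, MeasurableSet (A j)) {c : ℝ≥0∞}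
    (hc : ∀ᶠ j in atTop, c ≤ μ (A j)) : c ≤ μ {t | ∃ᶠ j in atTop, t ∈ A j} := by
  have e : {t | ∃ᶠ j in atTop, t ∈ A j} = ⋂ n, ⋃ j ≥ n, A j := by
    ext t
    simp [frequently_atTop]
  rw [e]
  have hanti : Antitone fun n => ⋃ j ≥ n, A j := fun m n hmn =>
    Set.iUnion₂_subset fun j hj => Set.subset_biUnion_of_mem (u := A) (le_trans hmn hj)
  refine ge_of_tendsto (tendsto_measure_iInter_atTop
    (fun n => (MeasurableSet.biUnion (Set.to_countable _) fun j _ => hA j).nullMeasurableSet)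
    hanti ⟨0, measure_ne_top _ _⟩) (Eventually.of_forall fun n => ?_)
  obtain ⟨j, hj, hn⟩ := (hc.and (eventually_ge_atTop n)).exists
  exact hj.trans (measure_mono (Set.subset_biUnion_of_mem (u := A) hn))

theorem addOrderOf_coe_eq_zero {α : ℝ} (hα : Irrational α) :
    addOrderOf (α : UnitAddCircle) = 0 := by
  rw [← AddCircle.denseRange_zsmul_iff, AddCircle.denseRange_zsmul_coe_iff, div_one]
  exact hα

/-- The points hitting the window of `r` at a time between `q` and `(1 / (2 |q α - p|) + C) / K`. -/
def lateHitting (α : ℝ) (r : ℚ) (K C : ℕ) : Set UnitAddCircle :=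
  ⋃ i ∈ {i : ℕ | r.den ≤ i ∧ 2 * (K * i - C : ℝ) * |approxError α r| ≤ 1},
    hitting α (approxError α r) i

theorem measurableSet_lateHitting (α : ℝ) (r : ℚ) (K C : ℕ) :
    MeasurableSet (lateHitting α r K C) :=
  MeasurableSet.biUnion (Set.to_countable _) fun i _ => measurableSet_hitting α _ i

/-- A common point would bring `(j - i)α` within `|δ|` of an integer, so `j - i ≥ 1/(2|δ|) ≥ j`,
impossible for `i > 0`. -/
theorem disjoint_hitting {α : ℝ} {r : ℚ} (hr : (r.den : ℝ) * |approxError α r| ≤ 1 / 2) {i j : ℕ}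
    (hi : 0 < i) (hij : i < j) (hj : 2 * j * |approxError α r| ≤ 1) :
    Disjoint (hitting α (approxError α r) i) (hitting α (approxError α r) j) := by
  rw [Set.disjoint_left]
  intro t h1 h2
  rw [mem_hitting] at h1 h2
  have ht := circleRep_mem t
  have h3 := abs_sub_lt_of_sub_notMem_Ico (rotation_iterate_mem ht j)
    (rotation_iterate_mem ht i) h2 h1
  rw [rotation_iterate α _ ht, rotation_iterate α _ ht, ← Int.self_sub_floor,
    ← Int.self_sub_floor] at h3
  have h4 : |((j - i : ℕ) : ℝ) * α - (⌊circleRep t + j * α⌋ - ⌊circleRep t + i * α⌋ : ℤ)|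
      < |approxError α r| := by
    convert h3 using 2
    push_cast [hij.le]
    ring
  have h5 := one_le_two_mul_of_abs_lt_approxError hr (by omega) h4
  push_cast [hij.le] at h5
  have h6 : (0 : ℝ) < i := by exact_mod_cast hi
  have h7 : 0 < |approxError α r| := (abs_nonneg _).trans_lt h3
  nlinarith

theorem le_volume_lateHitting {α : ℝ} (hα : Irrational α) {r : ℚ} {K : ℕ} (hK : 0 < K)
    (hr : (r.den : ℝ) * |approxError α r| ≤ 1 / (4 * K)) :
    ENNReal.ofReal (1 / (4 * K)) ≤ volume (lateHitting α r K 0) := by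
  have hK' : (1 : ℝ) ≤ K := by exact_mod_cast hK
  have hδ : 0 < |approxError α r| := abs_pos.2 (approxError_ne_zero hα r)
  set δ := |approxError α r|
  have hr4 : (1 : ℝ) / (4 * K) ≤ 1 / 2 := by
    apply one_div_le_one_div_of_le <;> linarith
  have hr2 : (r.den : ℝ) * δ ≤ 1 / 2 := hr.trans hr4
  -- All times below `M` are admissible, and `M * δ > 1/(2K)`. Discarding the times below `q` costs
  -- at most `1/(4K)`, which leaves `1/(4K)`.
  set M : ℕ := ⌊1 / (2 * K * δ)⌋₊ + 1 with hM
  have hlt : ∀ i < M, 2 * (K * i : ℝ) * δ ≤ 1 := by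
    intro i hi
    have h1 : (i : ℝ) ≤ 1 / (2 * K * δ) :=
      (Nat.le_floor_iff (by positivity)).1 (Nat.lt_succ_iff.1 hi)
    rw [le_div_iff₀ (by positivity)] at h1
    linarith
  have hsub : ⋃ i ∈ Finset.Ico r.den M, hitting α (approxError α r) i ⊆ lateHitting α r K 0 := by
    refine Set.iUnion₂_subset fun i hi => ?_
    rw [Finset.mem_Ico] at hi
    refine Set.subset_biUnion_of_mem (u := fun i => hitting α (approxError α r) i) ?_
    refine ⟨hi.1, ?_⟩
    simpa using hlt i hi.2
  refine le_trans ?_ (measure_mono hsub)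
  have hd : ∀ i ∈ Finset.Ico r.den M, ∀ j ∈ Finset.Ico r.den M, i < j →
      Disjoint (hitting α (approxError α r) i) (hitting α (approxError α r) j) := by
    intro i hi j hj hij
    rw [Finset.mem_Ico] at hi hj
    refine disjoint_hitting hr2 (r.pos.trans_le hi.1) hij ?_
    have h1 := hlt j hj.2
    have h2 : (j : ℝ) ≤ K * j := le_mul_of_one_le_left (Nat.cast_nonneg _) hK'
    nlinarith
  rw [measure_biUnion_finset _ fun i _ => measurableSet_hitting α _ i]
  · simp only [volume_hitting α (abs_approxError_le_one (hr2.trans (by norm_num))),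
      Finset.sum_const, Nat.card_Ico, nsmul_eq_mul]
    rw [← ENNReal.ofReal_natCast, ← ENNReal.ofReal_mul (Nat.cast_nonneg _)]
    apply ENNReal.ofReal_le_ofReal
    have h1 : 1 / (2 * K * δ) < M := by
      rw [hM]
      push_cast
      exact Nat.lt_floor_add_one _
    have h2 : (M : ℝ) ≤ (M - r.den : ℕ) + r.den := by
      exact_mod_cast (by omega : M ≤ M - r.den + r.den)
    have h3 : 1 / (2 * K * δ) * δ = 1 / (4 * K) + 1 / (4 * K) := by
      field_simp
      norm_num
    nlinarith [mul_lt_mul_of_pos_right h1 hδ, mul_le_mul_of_nonneg_right h2 hδ.le]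
  · intro i hi j hj hij
    rcases lt_or_gt_of_ne hij with h | h
    · exact hd i hi j hj h
    · exact (hd j hj i hi h).symm

theorem ae_frequently_mem_window {α : ℝ} (hα : Irrational α) (h : UnboundedPartialQuotients α)
    (K : ℕ) : ∀ᵐ t : UnitAddCircle, ∃ᶠ n : ℕ in atTop, ∃ r : ℚ, r.den ≤ n ∧
      (r.den : ℝ) * |approxError α r| ≤ 1 / 2 ∧ 2 * (K * n : ℝ) * |approxError α r| ≤ 1 ∧
      (rotation α)^[n] (circleRep t) - approxError α r ∉ Set.Ico (0 : ℝ) 1 := by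
  obtain ⟨r, hr⟩ := exists_approx_seq hα h
  -- The slack `C` makes the set backward invariant under the rotation; its `C = 0` piece already
  -- has positive measure.
  set E : Set UnitAddCircle :=
    ⋃ C : ℕ, {t | ∃ᶠ j in atTop, t ∈ lateHitting α (r j) (K + 1) C}
  have hmeas : MeasurableSet E := by
    refine MeasurableSet.iUnion fun C => ?_
    have e : {t | ∃ᶠ j in atTop, t ∈ lateHitting α (r j) (K + 1) C}
        = ⋂ n, ⋃ j ≥ n, lateHitting α (r j) (K + 1) C := by
      ext t
      simp [frequently_atTop]
    rw [e]
    exact MeasurableSet.iInter fun n =>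
      MeasurableSet.biUnion (Set.to_countable _) fun j _ => measurableSet_lateHitting α _ _ _
  have hpos : volume E ≠ 0 := by
    have hev : ∀ᶠ j in atTop, ENNReal.ofReal (1 / (4 * (K + 1 : ℕ)))
        ≤ volume (lateHitting α (r j) (K + 1) 0) := by
      have ht : Tendsto (fun j : ℕ => ((1 : ℝ) / 2) ^ (j + 1)) atTop (𝓝 0) :=
        (tendsto_pow_atTop_nhds_zero_of_lt_one (by norm_num) (by norm_num)).comp
          (tendsto_add_atTop_nat 1)
      have hp : (0 : ℝ) < 1 / (4 * (K + 1 : ℕ)) := by positivity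
      filter_upwards [ht.eventually (gt_mem_nhds hp)] with j hj
      exact le_volume_lateHitting hα K.succ_pos ((hr j).2.le.trans hj.le)
    have h1 := le_measure_setOf_frequently
      (fun j => measurableSet_lateHitting α (r j) (K + 1) 0) hev
    have h2 := h1.trans (measure_mono (Set.subset_iUnion
      (fun C : ℕ => {t | ∃ᶠ j in atTop, t ∈ lateHitting α (r j) (K + 1) C}) 0))
    refine ((ENNReal.ofReal_pos.2 ?_).trans_le h2).ne'
    positivity
  have hinv : (fun t : UnitAddCircle => t + (α : UnitAddCircle)) ⁻¹' E ⊆ E := by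
    intro t ht
    obtain ⟨C, hC⟩ := Set.mem_iUnion.1 ht
    -- A hit at time `i` from `t + α` is a hit at time `i + 1` from `t`; raising `C` by `K + 1`
    -- keeps `(K + 1) * i - C` unchanged.
    refine Set.mem_iUnion.2 ⟨C + (K + 1), hC.mono fun j hj => ?_⟩
    obtain ⟨i, ⟨hi1, hi2⟩, hi⟩ := Set.mem_iUnion₂.1 hj
    refine Set.mem_iUnion₂.2 ⟨i + 1, ⟨hi1.trans i.le_succ, ?_⟩, ?_⟩
    · convert hi2 using 3
      push_cast
      ring
    · have e : t + (((i + 1 : ℕ) * α : ℝ) : UnitAddCircle) = t + α + ((i * α : ℝ) : UnitAddCircle) := by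
        rw [add_assoc, ← AddCircle.coe_add]
        congr 2
        push_cast
        ring
      change _ ∈ window _
      rw [e]
      exact hi
  have huniv : E =ᵐ[volume] Set.univ := by
    rcases (AddCircle.ergodic_add_right.2 (addOrderOf_coe_eq_zero hα)).ae_empty_or_univ_of_preimage_ae_le
      hmeas.nullMeasurableSet hinv.eventuallyLE with h0 | h0
    · exact absurd (ae_eq_empty.1 h0) hpos
    · exact h0
  filter_upwards [eventuallyEq_univ.1 huniv] with t ht
  obtain ⟨C, hC⟩ := Set.mem_iUnion.1 ht
  rw [frequently_atTop]
  intro N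
  obtain ⟨j, hj, hjt⟩ := frequently_atTop.1 hC (max N C)
  obtain ⟨i, ⟨hi1, hi2⟩, hi⟩ := Set.mem_iUnion₂.1 hjt
  have hNC : max N C ≤ i := hj.trans ((hr j).1.le.trans hi1)
  refine ⟨i, (le_max_left _ _).trans hNC, r j, hi1, (hr j).2.le.trans ?_, ?_, mem_hitting.1 hi⟩
  · rw [pow_succ]
    have : ((1 : ℝ) / 2) ^ j ≤ 1 := pow_le_one₀ (by norm_num) (by norm_num)
    linarith
  · refine le_trans ?_ hi2
    -- Here the spare unit in `K + 1` absorbs the slack: `K * i ≤ (K + 1) * i - C`.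
    have : (C : ℝ) ≤ i := by exact_mod_cast (le_max_right _ _).trans hNC
    gcongr
    push_cast
    linarith

/-! ### Unique ergodicity of the rotation -/

theorem denseRange_nsmul_coe {α : ℝ} (hα : Irrational α) :
    DenseRange (fun k : ℕ => k • (α : UnitAddCircle)) := by
  rw [← denseRange_zsmul_iff_nsmul, AddCircle.denseRange_zsmul_iff]
  exact addOrderOf_coe_eq_zero hα

/-- Invariance under multiples of `α` extends by density, since the integral of a translated
continuous function depends continuously on the translation. -/
theorem map_add_right_eq_self {α : ℝ} (hα : Irrational α) {ν : Measure UnitAddCircle}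
    [IsProbabilityMeasure ν] (h : MeasurePreserving (· + (α : UnitAddCircle)) ν ν)
    (g : UnitAddCircle) : ν.map (· + g) = ν := by
  have hprob : ∀ g : UnitAddCircle, IsProbabilityMeasure (ν.map (· + g)) := fun g =>
    Measure.isProbabilityMeasure_map (measurable_add_const g).aemeasurable
  have hnat : ∀ k : ℕ, ν.map (· + k • (α : UnitAddCircle)) = ν := by
    intro k
    induction k with
    | zero => simp
    | succ k ih =>
      have e : (fun t : UnitAddCircle => t + (k + 1) • (α : UnitAddCircle))
          = (fun t => t + (α : UnitAddCircle)) ∘ fun t => t + k • (α : UnitAddCircle) := by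
        ext t
        simp [succ_nsmul, add_assoc]
      rw [e, ← Measure.map_map (measurable_add_const _) (measurable_add_const _), ih, h.map_eq]
  refine ext_of_forall_integral_eq_of_IsFiniteMeasure fun f => ?_
  have hmap : ∀ g : UnitAddCircle, ∫ t, f t ∂(ν.map (· + g)) = ∫ t, f (t + g) ∂ν := fun g =>
    integral_map (measurable_add_const g).aemeasurable f.continuous.aestronglyMeasurable
  have hcont : Continuous fun g : UnitAddCircle => ∫ t, f (t + g) ∂ν := by
    refine continuous_of_dominated (bound := fun _ => ‖f‖) (fun g => ?_) (fun g => ?_)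
      (integrable_const _) ?_
    · exact (f.continuous.comp (continuous_id.add continuous_const)).aestronglyMeasurable
    · exact Eventually.of_forall fun t => f.norm_coe_le_norm _
    · exact Eventually.of_forall fun t => f.continuous.comp (continuous_const.add continuous_id)
  rw [hmap]
  have hclosed : IsClosed {g : UnitAddCircle | ∫ t, f (t + g) ∂ν = ∫ t, f t ∂ν} :=
    isClosed_eq hcont continuous_const
  refine (denseRange_nsmul_coe hα).induction_on (p := fun g => ∫ t, f (t + g) ∂ν = ∫ t, f t ∂ν) g
    hclosed fun k => ?_
  rw [← hmap, hnat]

/-- The normalized Lebesgue measure is the only probability measure on the circle which is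
invariant under an irrational rotation. -/
theorem eq_volume_of_measurePreserving {α : ℝ} (hα : Irrational α) {ν : Measure UnitAddCircle}
    [IsProbabilityMeasure ν] (h : MeasurePreserving (· + (α : UnitAddCircle)) ν ν) :
    ν = volume := by
  have : ν.IsAddLeftInvariant := ⟨fun g => by
    simpa only [add_comm] using map_add_right_eq_self hα h g⟩
  have : IsProbabilityMeasure (volume : Measure UnitAddCircle) := ⟨UnitAddCircle.measure_univ⟩
  have h1 := Measure.isAddLeftInvariant_eq_smul ν (volume : Measure UnitAddCircle)
  have h2 := congrArg (fun m : Measure UnitAddCircle => m Set.univ) h1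
  simp only [Measure.smul_apply, measure_univ] at h2
  rw [h1]
  have h3 : ν.addHaarScalarFactor (volume : Measure UnitAddCircle) = 1 := by
    simpa [ENNReal.smul_def] using h2.symm
  rw [h3, one_smul]

/-! ### The projection of the Sturmian shift to the circle -/

/-- Density gives a time at which `s` is translated by some `y` with `s + y < 1 < t + y`; a shared
itinerary would move `t` by the same `y`, out of the circle's fundamental domain. -/
theorem false_of_lt_of_mem_wordInterval {α : ℝ} (hα : Irrational α) (hα0 : 0 < α) (hα1 : α < 1)
    {x : ℕ → Fin 2} {s t : ℝ} (hst : s < t) (hs : ∀ n, s ∈ wordInterval α (pref x n))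
    (ht : ∀ n, t ∈ wordInterval α (pref x n)) : False := by
  have hs1 := (hs 0).1
  have ht1 := (ht 0).1
  obtain ⟨k, y, hy, hk⟩ := (denseRange_nsmul_coe hα).exists_mem_open
    (QuotientAddGroup.isOpenMap_coe (N := AddSubgroup.zmultiples (1 : ℝ)) _
      (isOpen_Ioo (a := 1 - t) (b := 1 - s)))
    ((Set.nonempty_Ioo.2 (by linarith)).image _)
  have e : (rotation α)^[k] s = s + y := by
    rw [rotation_iterate α s hs1, ← circleRep_coe, AddCircle.coe_add]
    have : ((k * α : ℝ) : UnitAddCircle) = (y : UnitAddCircle) := by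
      rw [← nsmul_eq_mul, AddCircle.coe_nsmul]
      exact hk.symm
    rw [this, ← AddCircle.coe_add, circleRep_coe, Int.fract_eq_self]
    exact ⟨by linarith [hy.1, hs1.1, ht1.2], by linarith [hy.2]⟩
  have e1 := rotation_iterate_eq_add_sum hα0 hα1 (hs k) le_rfl
  have e2 := rotation_iterate_eq_add_sum hα0 hα1 (ht k) le_rfl
  linarith [hy.1, (rotation_iterate_mem (α := α) ht1 k).2]

theorem eq_of_mem_closure_wordInterval {α : ℝ} (hα : Irrational α) (hα0 : 0 < α) (hα1 : α < 1)
    {x : ℕ → Fin 2} {y z : ℝ} (hy : ∀ n, y ∈ closure (wordInterval α (pref x n)))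
    (hz : ∀ n, z ∈ closure (wordInterval α (pref x n))) : y = z := by
  by_contra hne
  wlog hlt : y < z generalizing y z
  · exact this hz hy (Ne.symm hne) (lt_of_le_of_ne (not_lt.1 hlt) (Ne.symm hne))
  have key : ∀ s ∈ Set.Ioo y z, ∀ n, s ∈ wordInterval α (pref x n) := by
    intro s hs n
    obtain ⟨u, hu1, hu2⟩ := mem_closure_iff.1 (hy n) (Set.Iio s) isOpen_Iio hs.1
    obtain ⟨v, hv1, hv2⟩ := mem_closure_iff.1 (hz n) (Set.Ioi s) isOpen_Ioi hs.2
    exact (wordInterval_ordConnected hα0 hα1 x n).out hu2 hv2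
      ⟨(Set.mem_Iio.1 hu1).le, (Set.mem_Ioi.1 hv1).le⟩
  obtain ⟨s, hs1, hs2⟩ := exists_between hlt
  obtain ⟨t, ht1, ht2⟩ := exists_between hs2
  exact false_of_lt_of_mem_wordInterval hα hα0 hα1 ht1 (key s ⟨hs1, hs2⟩)
    (key t ⟨hs1.trans ht1, ht2⟩)

theorem wordInterval_subset_Icc (α : ℝ) {n : ℕ} (u : Fin n → Fin 2) :
    wordInterval α u ⊆ Set.Icc 0 1 := fun _ ht => ⟨ht.1.1, ht.1.2.le⟩

/-- Closures are taken because nested half-open intervals can have empty intersection. -/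
theorem exists_mem_closure_wordInterval {α : ℝ} (x : sturmianShift α) :
    ∃ y, ∀ n, y ∈ closure (wordInterval α (pref (x : ℕ → Fin 2) n)) := by
  have h := IsCompact.nonempty_iInter_of_sequence_nonempty_isCompact_isClosed
    (fun n => closure (wordInterval α (pref (x : ℕ → Fin 2) n)))
    (fun n => closure_mono (wordInterval_anti _ n.le_succ))
    (fun n => (x.2 n).closure)
    (isCompact_Icc.closure_of_subset (wordInterval_subset_Icc α _))
    (fun n => isClosed_closure)
  obtain ⟨y, hy⟩ := h
  exact ⟨y, Set.mem_iInter.1 hy⟩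

/-- The point of the closed unit interval which lies in the closures of all intervals `I_{x(n)}`. -/
noncomputable def sturmianPoint {α : ℝ} (x : sturmianShift α) : ℝ :=
  (exists_mem_closure_wordInterval x).choose

theorem sturmianPoint_mem {α : ℝ} (x : sturmianShift α) (n : ℕ) :
    sturmianPoint x ∈ closure (wordInterval α (pref (x : ℕ → Fin 2) n)) :=
  (exists_mem_closure_wordInterval x).choose_spec n

open Classical in
/-- A point of the interval of the word `u`, if there is one. -/
noncomputable def wordPoint (α : ℝ) {n : ℕ} (u : Fin n → Fin 2) : ℝ :=
  if h : (wordInterval α u).Nonempty then h.some else 0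

theorem wordPoint_mem {α : ℝ} (x : sturmianShift α) (n : ℕ) :
    wordPoint α (pref (x : ℕ → Fin 2) n) ∈ wordInterval α (pref (x : ℕ → Fin 2) n) := by
  rw [wordPoint, dif_pos (x.2 n)]
  exact (x.2 n).some_mem

/-- Every cluster point lies in all the closures, hence is unique. This makes `sturmianPoint` a
limit of functions of finite prefixes, and so measurable. -/
theorem tendsto_wordPoint {α : ℝ} (hα : Irrational α) (hα0 : 0 < α) (hα1 : α < 1)
    (x : sturmianShift α) :
    Tendsto (fun n => wordPoint α (pref (x : ℕ → Fin 2) n)) atTop (𝓝 (sturmianPoint x)) := by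
  refine (isCompact_Icc (a := (0 : ℝ)) (b := 1)).tendsto_nhds_of_unique_mapClusterPt
    (Eventually.of_forall fun n => wordInterval_subset_Icc α _ (wordPoint_mem x n)) fun y _ hy => ?_
  refine eq_of_mem_closure_wordInterval hα hα0 hα1 (fun n => ?_) (sturmianPoint_mem x)
  rw [mem_closure_iff_clusterPt]
  refine ClusterPt.mono hy (tendsto_principal.2 ?_)
  filter_upwards [eventually_ge_atTop n] with m hm
  exact wordInterval_anti _ hm (wordPoint_mem x m)

theorem measurable_sturmianPoint {α : ℝ} (hα : Irrational α) (hα0 : 0 < α) (hα1 : α < 1) :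
    Measurable (sturmianPoint : sturmianShift α → ℝ) := by
  refine measurable_of_tendsto_metrizable (f := fun n (x : sturmianShift α) =>
    wordPoint α (pref (x : ℕ → Fin 2) n)) (fun n => ?_)
    (tendsto_pi_nhds.2 fun x => tendsto_wordPoint hα hα0 hα1 x)
  refine (measurable_of_countable (wordPoint α (n := n))).comp ?_
  exact measurable_pi_lambda _ fun i => (measurable_pi_apply _).comp measurable_subtype_coe

theorem sturmianPoint_sturmianMap {α : ℝ} (hα : Irrational α) (hα0 : 0 < α) (hα1 : α < 1)
    (x : sturmianShift α) : sturmianPoint (sturmianMap α x)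
      = sturmianPoint x + displacement α ((x : ℕ → Fin 2) 0) := by
  refine eq_of_mem_closure_wordInterval hα hα0 hα1 (sturmianPoint_mem (sturmianMap α x))
    fun n => ?_
  refine map_mem_closure (f := fun s => s + displacement α ((x : ℕ → Fin 2) 0))
    (continuous_id.add continuous_const) (sturmianPoint_mem x (n + 1)) fun s hs => ?_
  have h0 : rotation α s = s + displacement α ((x : ℕ → Fin 2) 0) :=
    rotation_eq_add_displacement hα0 hα1 (hs.2 0)
  beta_reduce
  rw [← h0]
  refine ⟨fract_mem_Ico _, fun k => ?_⟩
  rw [← Function.iterate_succ_apply]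
  exact hs.2 k.succ

theorem exists_sum_displacement_eq (α : ℝ) (x : ℕ → Fin 2) (k : ℕ) :
    ∃ m : ℤ, ∑ i ∈ Finset.range k, displacement α (x i) = k * α + m := by
  induction k with
  | zero => exact ⟨0, by simp⟩
  | succ k ih =>
    obtain ⟨m, hm⟩ := ih
    rw [Finset.sum_range_succ, hm, displacement]
    split_ifs
    · exact ⟨m, by push_cast; ring⟩
    · exact ⟨m - 1, by push_cast; ring⟩

theorem coe_intCast_eq_zero (m : ℤ) : ((m : ℝ) : UnitAddCircle) = 0 :=
  (AddCircle.coe_eq_zero_iff 1).2 ⟨m, by simp⟩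

/-- Closing a letter interval adds only its right endpoint. Reaching `1` at time `k`, or `1 - α` at
time `k` and hence `1` at time `k + 1`, would put the orbit at 0 on the circle. -/
theorem isItinerary_sturmianPoint {α : ℝ} (hα0 : 0 < α) (hα1 : α < 1) (x : sturmianShift α)
    (hx : ∀ k : ℕ, (sturmianPoint x : UnitAddCircle) + ((k * α : ℝ) : UnitAddCircle) ≠ 0) :
    IsItinerary α x (sturmianPoint x) := by
  have key : ∀ k, sturmianPoint x + ∑ i ∈ Finset.range k, displacement α ((x : ℕ → Fin 2) i)
      ∈ letterInterval α ((x : ℕ → Fin 2) k) := by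
    intro k
    have h : sturmianPoint x + ∑ i ∈ Finset.range k, displacement α ((x : ℕ → Fin 2) i)
        ∈ closure (letterInterval α ((x : ℕ → Fin 2) k)) := by
      refine map_mem_closure
        (f := fun s => s + ∑ i ∈ Finset.range k, displacement α ((x : ℕ → Fin 2) i))
        (continuous_id.add continuous_const) (sturmianPoint_mem x (k + 1)) fun s hs => ?_
      beta_reduce
      rw [← rotation_iterate_eq_add_sum hα0 hα1 hs k.le_succ]
      exact hs.2 ⟨k, k.lt_succ_self⟩
    obtain ⟨m, hm⟩ := exists_sum_displacement_eq α x k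
    rw [hm] at h ⊢
    unfold letterInterval at h ⊢
    split_ifs at h ⊢
    · rw [closure_Ico (by linarith)] at h
      refine ⟨h.1, lt_of_le_of_ne h.2 fun he => hx (k + 1) ?_⟩
      rw [← AddCircle.coe_add, ← coe_intCast_eq_zero (1 - m)]
      congr 1
      push_cast
      linarith
    · rw [closure_Ico (by linarith)] at h
      refine ⟨h.1, lt_of_le_of_ne h.2 fun he => hx k ?_⟩
      rw [← AddCircle.coe_add, ← coe_intCast_eq_zero (1 - m)]
      congr 1
      push_cast
      linarith
  have hsub : ∀ a, letterInterval α a ⊆ Set.Ico 0 1 := by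
    intro a t ht
    unfold letterInterval at ht
    split_ifs at ht
    · exact ⟨ht.1, by linarith [ht.2]⟩
    · exact ⟨by linarith [ht.1], ht.2⟩
  have h0 : sturmianPoint x ∈ Set.Ico (0 : ℝ) 1 := by simpa using hsub _ (key 0)
  refine ⟨h0, fun k => ?_⟩
  convert key k using 1
  obtain ⟨m, hm⟩ := exists_sum_displacement_eq α x k
  have h1 := hsub _ (key k)
  rw [hm] at h1 ⊢
  rw [rotation_iterate α _ h0, Int.fract_eq_iff]
  exact ⟨h1.1, h1.2, -m, by push_cast; ring⟩

theorem measurePreserving_coe_sturmianPoint {α : ℝ} (hα : Irrational α) (hα0 : 0 < α)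
    (hα1 : α < 1) {μ : Measure (sturmianShift α)} [IsProbabilityMeasure μ]
    (hμ : MeasurePreserving (sturmianMap α) μ μ) :
    MeasurePreserving (fun x : sturmianShift α => (sturmianPoint x : UnitAddCircle)) μ volume := by
  have hm : Measurable (fun x : sturmianShift α => (sturmianPoint x : UnitAddCircle)) :=
    AddCircle.measurable_mk'.comp (measurable_sturmianPoint hα hα0 hα1)
  have := Measure.isProbabilityMeasure_map (μ := μ) hm.aemeasurable
  refine ⟨hm, eq_volume_of_measurePreserving hα ⟨measurable_add_const _, ?_⟩⟩
  rw [Measure.map_map (measurable_add_const _) hm]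
  have e : (fun t : UnitAddCircle => t + (α : UnitAddCircle)) ∘
      (fun x : sturmianShift α => (sturmianPoint x : UnitAddCircle))
      = (fun x : sturmianShift α => (sturmianPoint x : UnitAddCircle)) ∘ sturmianMap α := by
    ext x
    simp only [Function.comp_apply, sturmianPoint_sturmianMap hα hα0 hα1, displacement]
    split_ifs
    · rw [AddCircle.coe_add]
    · have h1 : ((1 : ℝ) : UnitAddCircle) = 0 := AddCircle.coe_period 1
      rw [AddCircle.coe_add, AddCircle.coe_sub, h1, sub_zero]
  rw [e, ← Measure.map_map hm hμ.measurable, hμ.map_eq]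

theorem volume_singleton_eq_zero (t : UnitAddCircle) : volume {t} = 0 := by
  have h : ({t} : Set UnitAddCircle) ⊆ circleRep ⁻¹' {circleRep t} := by simp
  refine measure_mono_null h ?_
  rw [volume_circleRep_preimage (measurableSet_singleton _)]
  exact measure_mono_null Set.inter_subset_left Real.volume_singleton

theorem ae_add_ne_zero (α : ℝ) :
    ∀ᵐ t : UnitAddCircle, ∀ k : ℕ, t + ((k * α : ℝ) : UnitAddCircle) ≠ 0 := by
  rw [ae_all_iff]
  intro k
  filter_upwards [compl_mem_ae_iff.2 (volume_singleton_eq_zero (-((k * α : ℝ) : UnitAddCircle)))]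
    with t ht h
  exact ht (eq_neg_of_add_eq_zero_left h)

end Sturmian

/-! ### Pulling the almost-sure statements back to the Sturmian shift. -/

theorem mainTheorem2 (α : ℝ) (hα : Irrational α) (hα0 : 0 < α) (hα1 : α < 1)
    (hunb : Sturmian.UnboundedPartialQuotients α)
    (μ : Measure (Sturmian.sturmianShift α)) [IsProbabilityMeasure μ]
    (hμ : MeasurePreserving (Sturmian.sturmianMap α) μ μ) :
    ∀ᵐ x ∂μ,
      Sturmian.lowerReturnRate (Sturmian.sturmianShift α) (Sturmian.sturmianMap α) x = 0 ∧
      Sturmian.upperReturnRate (Sturmian.sturmianShift α) (Sturmian.sturmianMap α) x = ⊤ := by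
  have hπ := (Sturmian.measurePreserving_coe_sturmianPoint hα hα0 hα1 hμ).quasiMeasurePreserving
  filter_upwards [hπ.ae (Sturmian.ae_add_ne_zero α),
    hπ.ae (ae_all_iff.2 (Sturmian.ae_frequently_recurrent hα hunb)),
    hπ.ae (ae_all_iff.2 (Sturmian.ae_frequently_mem_window hα hunb))] with x hx hlow hup
  have hit := Sturmian.isItinerary_sturmianPoint hα0 hα1 x hx
  rw [Sturmian.circleRep_coe, Int.fract_eq_self.2 hit.1] at hlow hup
  refine ⟨Sturmian.lowerReturnRate_eq_zero fun m => (hlow m).mono ?_,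
    Sturmian.upperReturnRate_eq_top fun K => (hup K).mono ?_⟩
  · rintro n ⟨r, hr, hn⟩
    have h := Sturmian.returnTime_cylinder_le x r.pos fun j hj =>
      hit.apply_add_eq hα0 hα1 hn hj
    calc _ ≤ (m : ℕ∞) * r.den := by gcongr
      _ ≤ n := by exact_mod_cast hr
  · rintro n ⟨r, hr, hr2, hK, hn⟩
    exact Sturmian.mul_le_returnTime_cylinder hα hα0 hα1 x (hit.mem_wordInterval n) hr hr2 hK hn
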